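/- Fix countably infinite sets of constants and of variables. Every predicate $R$ has an arity $\mathrm{ar}(R)\ge 1$. A database $D$ is a finite set of atoms over constants, and $|D|$ is its cardinality. A TGD $\sigma$ is a constant-free sentence $\forall\bar x\forall\bar y(\phi(\bar x,\bar y)\to\exists\bar z\,\psi(\bar x,\bar z))$, with $\phi$ (the body) and $\psi$ (the head) non-empty conjunctions, i.e. finite sets, of atoms; its frontier $\mathrm{fr}(\sigma)$ is the set of variables occurring both in the body and in the head, and the variables $\bar z$ that occur only in the head are existentially quantified. The TGD is simple linear if its body is a single atom in which no variable occurs more than once. For a finite set $\Sigma$ of TGDs, $\mathrm{atoms}(\Sigma)$ is the set of atoms and $\mathrm{sch}(\Sigma)$ the set of predicates occurring in $\Sigma$, $\mathrm{ar}(\Sigma)$ is the maximum arity over $\mathrm{sch}(\Sigma)$ ($0$ if $\Sigma=\emptyset$), $\|\Sigma\|=|\mathrm{atoms}(\Sigma)|\cdot|\mathrm{sch}(\Sigma)|\cdot\mathrm{ar}(\Sigma)$, $\mathsf d_{SL}(\Sigma)=|\mathrm{sch}(\Sigma)|\cdot\mathrm{ar}(\Sigma)$ and $$f_{SL}(\Sigma)=(\mathsf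 d_{SL}(\Sigma)+1)\cdot\|\Sigma\|^{\,2\cdot\mathrm{ar}(\Sigma)\cdot(\mathsf d_{SL}(\Sigma)+1)}\qquad(\text{with }0^0=1).$$ Semi-oblivious chase. An instance is a possibly infinite set of atoms over constants and nulls. A trigger for $\Sigma$ on an instance $I$ is a pair $(\sigma,h)$ with $\sigma\in\Sigma$ and $h$ a map from the variables of the body of $\sigma$ to constants and nulls that sends every body atom into $I$. Its result is obtained from the head of $\sigma$ by replacing each $x\in\mathrm{fr}(\sigma)$ by $h(x)$ and every other variable $x$ by the null $\bot^{x}_{\sigma,h|_{\mathrm{fr}(\sigma)}}$, whose name is uniquely determined by $\sigma$, $h|_{\mathrm{fr}(\sigma)}$ and $x$. The trigger is active on $I$ if its result is not contained in $I$. A chase derivation of $D$ w.r.t. $\Sigma$ is a sequence $I_0=D,I_1,\dots$ of instances, each $I_{i+1}$ being the union of $I_i$ and the result of a trigger active on $I_i$, which is either infinite, or finite with no active trigger on its last instance. It is valid if it is finite, or if it is infinite and fair (for every trigger active on some $I_i$ there is $j>i$ such that it is not active on $I_j$). Its result is its last instance if it is finite, and $\bigcup_i I_i$ if it is infinite. Weak-acyclicity.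 The dependency graph of $\Sigma$ is the directed multigraph on the positions $(R,i)$, $R\in\mathrm{sch}(\Sigma)$, $1\le i\le\mathrm{ar}(R)$, with exactly the following edges. For each $\sigma\in\Sigma$, each $x\in\mathrm{fr}(\sigma)$ and each position $\pi$ of $x$ in the body of $\sigma$: a normal edge from $\pi$ to every position of $x$ in the head of $\sigma$, and a special edge from $\pi$ to every position in the head of $\sigma$ of an existentially quantified variable of $\sigma$. Let $\rightsquigarrow_\Sigma$ be the reflexive and transitive closure on $\mathrm{sch}(\Sigma)$ of the relation "some $\sigma\in\Sigma$ has $R$ in its body and $P$ in its head". A cycle (a closed path, not necessarily simple) is $D$-supported if there are an atom of $D$ with a predicate $R$ and a node $(P,i)$ of the cycle with $R\rightsquigarrow_\Sigma P$. The set $\Sigma$ is $D$-weakly-acyclic if no $D$-supported cycle of the dependency graph contains a special edge. **Theorem.** Let $D$ be a database and let $\Sigma$ be a finite set of simple linear TGDs, no two of which share a variable. There is a valid chase derivation of $D$ w.r.t. $\Sigma$, and all valid chase derivations of $D$ w.r.t. $\Sigma$ have the same result, denoted $\mathsf{chase}(D,\Sigma)$. Moreover, the following are equivalent: 1. The chase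 of $D$ w.r.t. $\Sigma$ terminates, in each of the following senses, which are equivalent to each other: every valid chase derivation of $D$ w.r.t. $\Sigma$ is finite; some valid chase derivation of $D$ w.r.t. $\Sigma$ is finite; $\mathsf{chase}(D,\Sigma)$ is finite. 2. $|\mathsf{chase}(D,\Sigma)|\le|D|\cdot f_{SL}(\Sigma)$. 3. $\Sigma$ is $D$-weakly-acyclic. -/

import Mathlib

namespace SOChase

/-! ### Terms, atoms, databases, instances -/

/-- The countably infinite set of constants. -/
abbrev Const : Type := ℕ

/-- The countably infinite set of variables. -/
abbrev Var : Type := ℕ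

/-- A relation symbol `R/n`, with `n > 0`. -/
structure Predicate where
  name : ℕ
  arity : ℕ
  arity_pos : 0 < arity
  deriving DecidableEq

/-- An atom `R(t₁,…,tₙ)` with arguments from `τ`. -/
structure Atom (τ : Type) where
  pred : Predicate
  args : Fin pred.arity → τ
  deriving DecidableEq

/-- Apply a substitution to an atom. -/
def Atom.map {α β : Type} (f : α → β) (a : Atom α) : Atom β :=
  ⟨a.pred, fun i => f (a.args i)⟩

/-- The variables occurring in an atom. -/
def Atom.vars (a : Atom Var) : Finset Var := Finset.univ.image a.args

/-- A database: a finite set of facts (atoms all of whose arguments are constants). -/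
abbrev Database : Type := Finset (Atom Const)

/-! ### Tuple-generating dependencies -/

/-- A (constant-free) TGD `φ(x̄,ȳ) → ∃ z̄ ψ(x̄,z̄)`; conjunctions are treated as sets of atoms.
The frontier `x̄` consists of the variables shared by body and head, and `z̄` of the variables
that occur only in the head. -/
structure TGD where
  body : Finset (Atom Var)
  head : Finset (Atom Var)
  body_nonempty : body.Nonempty
  head_nonempty : head.Nonempty

namespace TGD

def bodyVars (σ : TGD) : Finset Var := σ.body.biUnion Atom.vars

def headVars (σ : TGD) : Finset Var := σ.head.biUnion Atom.vars

/-- All the variables of the TGD. -/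
def vars (σ : TGD) : Finset Var := σ.bodyVars ∪ σ.headVars

/-- The frontier. -/
def frontier (σ : TGD) : Finset Var := σ.bodyVars ∩ σ.headVars

/-- The existentially quantified variables. -/
def exVars (σ : TGD) : Finset Var := σ.headVars \ σ.bodyVars

/-- The atoms occurring in the TGD. -/
def atoms (σ : TGD) : Finset (Atom Var) := σ.body ∪ σ.head

/-- Simple linear: the body is a single atom, in which no variable occurs more than once. -/
def IsSimpleLinear (σ : TGD) : Prop :=
  ∃ a : Atom Var, σ.body = {a} ∧ Function.Injective a.args

end TGD

/-- `T` is a set of simple linear TGDs. -/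
def IsSL (T : Finset TGD) : Prop := ∀ σ ∈ T, σ.IsSimpleLinear

/-- No two TGDs of `T` share a variable. -/
def StandardizedApart (T : Finset TGD) : Prop :=
  ∀ σ ∈ T, ∀ τ ∈ T, σ ≠ τ → Disjoint σ.vars τ.vars

/-- The set of atoms occurring in the TGDs of `T`. -/
def atoms (T : Finset TGD) : Finset (Atom Var) := T.biUnion TGD.atoms

/-- The schema of `T`: the predicates occurring in `T`. -/
def sch (T : Finset TGD) : Finset Predicate := (atoms T).image Atom.pred

/-- The maximum arity over the predicates of the schema (`0` if `T` is empty). -/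
def ar (T : Finset TGD) : ℕ := (sch T).sup Predicate.arity

/-- The number `‖T‖`. -/
def size (T : Finset TGD) : ℕ := (atoms T).card * (sch T).card * ar T

/-- The depth bound `d_SL`. -/
def dSL (T : Finset TGD) : ℕ := (sch T).card * ar T

/-- The function `f_SL`. -/
def fSL (T : Finset TGD) : ℕ := (dSL T + 1) * size T ^ (2 * ar T * (dSL T + 1))

/-! ### The semi-oblivious chase -/

/-- Ground terms: the constants, and the nulls `⊥^x_{σ,h}` with `h` a substitution defined on the
frontier of `σ`. The name of a null determines `σ`, `x` and `h`, and no null is a constant. -/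
inductive GTerm : Type
  | const (c : Const) : GTerm
  | null (σ : TGD) (x : Var) (h : {y : Var // y ∈ σ.frontier} → GTerm) : GTerm

/-- An instance: a possibly infinite set of atoms over constants and nulls. -/
abbrev Instance : Type := Set (Atom GTerm)

/-- A database seen as an instance. -/
def Database.toInstance (D : Database) : Instance :=
  {a | ∃ b ∈ D, a = b.map GTerm.const}

/-- A pair `(σ,h)`. Only the values of `h` on the variables of the body of `σ` are relevant. -/
structure Trigger where
  tgd : TGD
  hom : Var → GTerm

namespace Trigger

/-- `(σ,h)` is a trigger for `T` on `I`: `σ ∈ T` and `h` maps the body of `σ` into `I`. -/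
def IsOn (t : Trigger) (T : Finset TGD) (I : Instance) : Prop :=
  t.tgd ∈ T ∧ ∀ a ∈ t.tgd.body, a.map t.hom ∈ I

/-- The substitution `μ`: it agrees with `h` on the frontier, and sends every other variable `x`
of the head to the null named by `σ`, the restriction of `h` to the frontier, and `x`. -/
def subst (t : Trigger) (x : Var) : GTerm :=
  if x ∈ t.tgd.frontier then t.hom x
  else GTerm.null t.tgd x (fun y => t.hom y.1)

/-- The result of a trigger. -/
def result (t : Trigger) : Instance :=
  {a | ∃ b ∈ t.tgd.head, a = b.map t.subst}

/-- `(σ,h)` is an active trigger for `T` on `I`. -/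
def IsActive (t : Trigger) (T : Finset TGD) (I : Instance) : Prop :=
  t.IsOn T I ∧ ¬ t.result ⊆ I

end Trigger

/-- `J` is obtained from `I` by applying an active trigger. -/
def ChaseStep (T : Finset TGD) (I J : Instance) : Prop :=
  ∃ t : Trigger, t.IsActive T I ∧ J = I ∪ t.result

/-- Sequences of instances, either finite `(I_i)_{0 ≤ i ≤ n}` or infinite `(I_i)_{i ≥ 0}`. -/
inductive ChaseSeq : Type
  | fin (n : ℕ) (I : Fin (n + 1) → Instance) : ChaseSeq
  | inf (I : ℕ → Instance) : ChaseSeq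

namespace ChaseSeq

/-- The sequence is a chase derivation of `D` w.r.t. `T`. -/
def IsDerivation (D : Database) (T : Finset TGD) : ChaseSeq → Prop
  | fin n I => I 0 = D.toInstance ∧ (∀ i : Fin n, ChaseStep T (I i.castSucc) (I i.succ)) ∧
      ¬ ∃ t : Trigger, t.IsActive T (I (Fin.last n))
  | inf I => I 0 = D.toInstance ∧ ∀ i : ℕ, ChaseStep T (I i) (I (i + 1))

/-- Fairness of an infinite sequence; finite sequences are not constrained. -/
def IsFair (T : Finset TGD) : ChaseSeq → Prop
  | fin _ _ => True
  | inf I => ∀ (i : ℕ) (t : Trigger), t.IsActive T (I i) → ∃ j > i, ¬ t.IsActive T (I j)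

/-- Valid chase derivations: the finite ones, and the infinite and fair ones. -/
def IsValid (D : Database) (T : Finset TGD) (δ : ChaseSeq) : Prop :=
  δ.IsDerivation D T ∧ δ.IsFair T

/-- The sequence is finite. -/
def IsFinite : ChaseSeq → Prop
  | fin _ _ => True
  | inf _ => False

/-- The result of a chase derivation: the last instance if it is finite, else the union. -/
def result : ChaseSeq → Instance
  | fin n I => I (Fin.last n)
  | inf I => ⋃ i, I i

end ChaseSeq

/-- `I` is the result of some valid chase derivation of `D` w.r.t. `T`. -/
def IsChaseResult (D : Database) (T : Finset TGD) (I : Instance) : Prop :=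
  ∃ δ : ChaseSeq, δ.IsValid D T ∧ δ.result = I

/-- `T ∈ CT^∀_D`: every valid chase derivation of `D` w.r.t. `T` is finite. -/
def CTAll (D : Database) (T : Finset TGD) : Prop :=
  ∀ δ : ChaseSeq, δ.IsValid D T → δ.IsFinite

/-- `T ∈ CT^∃_D`: some valid chase derivation of `D` w.r.t. `T` is finite. -/
def CTEx (D : Database) (T : Finset TGD) : Prop :=
  ∃ δ : ChaseSeq, δ.IsValid D T ∧ δ.IsFinite

/-! ### Non-uniform weak-acyclicity -/

/-- A predicate position `(R,i)`. -/
structure Position where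
  pred : Predicate
  idx : Fin pred.arity

/-- The variable `x` occurs in the atom `a` at position `π`, i.e. `π ∈ pos(a,x)`. -/
def OccursAt (x : Var) (a : Atom Var) (π : Position) : Prop :=
  ∃ i : Fin a.pred.arity, a.args i = x ∧ π = ⟨a.pred, i⟩

inductive EdgeKind : Type
  | normal
  | special

/-- The edges of the dependency graph of `T`. -/
def DepEdge (T : Finset TGD) (k : EdgeKind) (π π' : Position) : Prop :=
  ∃ σ ∈ T, ∃ x ∈ σ.frontier, (∃ b ∈ σ.body, OccursAt x b π) ∧
    match k with
    | .normal => ∃ a ∈ σ.head, OccursAt x a π'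
    | .special => ∃ z ∈ σ.exVars, ∃ a ∈ σ.head, OccursAt z a π'

/-- A cycle of the dependency graph: a path (not necessarily simple) whose first and last nodes
coincide. -/
structure DepCycle (T : Finset TGD) where
  len : ℕ
  node : Fin (len + 1) → Position
  kind : Fin len → EdgeKind
  isEdge : ∀ i : Fin len, DepEdge T (kind i) (node i.castSucc) (node i.succ)
  closed : node 0 = node (Fin.last len)

/-- The relation `R →_T P` on the predicates of the schema of `T`. -/
def PredStep (T : Finset TGD) (R P : Predicate) : Prop :=
  R ∈ sch T ∧ P ∈ sch T ∧
    (R = P ∨ ∃ σ ∈ T, (∃ b ∈ σ.body, b.pred = R) ∧ (∃ a ∈ σ.head, a.pred = P))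

/-- `P` is reachable from `R` w.r.t. `T`. -/
def Reachable (T : Finset TGD) : Predicate → Predicate → Prop :=
  Relation.TransGen (PredStep T)

/-- The cycle contains a special edge. -/
def DepCycle.HasSpecialEdge {T : Finset TGD} (C : DepCycle T) : Prop :=
  ∃ i : Fin C.len, C.kind i = EdgeKind.special

/-- The cycle is `D`-supported. -/
def DepCycle.IsSupported {T : Finset TGD} (C : DepCycle T) (D : Database) : Prop :=
  ∃ a ∈ D, ∃ i : Fin (C.len + 1), Reachable T a.pred (C.node i).pred

/-- `T` is weakly-acyclic w.r.t. `D`. -/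
def WeaklyAcyclic (D : Database) (T : Finset TGD) : Prop :=
  ¬ ∃ C : DepCycle T, C.IsSupported D ∧ C.HasSpecialEdge

end SOChase

open SOChase

namespace SOChase

/-! Every valid derivation, finite or infinite and fair, ends in the least instance `chase T I₀`
containing `I₀` and closed under triggers (`result_of_isValid`); this gives uniqueness, and reduces
termination to finiteness of that set. Existence comes from always applying an active trigger of
least rank (`exists_isValid`).

Weak-acyclicity bounds the size in two steps. A term at position π has depth at most the number of
positions from which π is reachable: a special edge enlarges this set strictly, since otherwise it
would close a supported cycle (`depth_le_card_ancestors`). So depths are at most `dSL T`. Next,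
since bodies are single atoms, the chase of D is the union of the chases of its atoms, whence the
factor |D|. In the chase of one atom, terms of depth at most m that occur together already occur
together in one of m + 1 explicit finite levels (`exists_mem_levels`); counting these levels, and
the ways to fill an atom from the terms of one level atom, gives `fSL T`.

Conversely, in a simple linear set every atom over a body predicate fires the rule, so depth is
carried along normal edges and grows along special ones. Going round a supported special cycle
repeatedly produces unbounded depth (`weaklyAcyclic_of_finite`). -/

/-! ### The least instance closed under triggers -/

/-- The atoms derivable from `I₀` by applying triggers for `T`. -/
inductive Derivable (T : Finset TGD) (I₀ : Instance) : Atom GTerm → Prop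
  | base {a : Atom GTerm} (ha : a ∈ I₀) : Derivable T I₀ a
  | step (t : Trigger) (ht : t.tgd ∈ T) (hb : ∀ a ∈ t.tgd.body, Derivable T I₀ (a.map t.hom))
      {b : Atom Var} (hh : b ∈ t.tgd.head) : Derivable T I₀ (b.map t.subst)

/-- The least instance that contains `I₀` and is closed under the triggers for `T`. -/
def chase (T : Finset TGD) (I₀ : Instance) : Instance := {a | Derivable T I₀ a}

lemma subset_chase (T : Finset TGD) (I₀ : Instance) : I₀ ⊆ chase T I₀ :=
  fun _ ha => Derivable.base ha

lemma Trigger.result_subset_chase {T : Finset TGD} {I₀ : Instance} {t : Trigger}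
    (ht : t.IsOn T (chase T I₀)) : t.result ⊆ chase T I₀ := by
  rintro a ⟨b, hb, rfl⟩
  exact Derivable.step t ht.1 ht.2 hb

lemma chase_subset {T : Finset TGD} {I₀ J : Instance} (h₀ : I₀ ⊆ J)
    (hJ : ∀ t : Trigger, t.IsOn T J → t.result ⊆ J) : chase T I₀ ⊆ J := by
  intro a ha
  induction ha with
  | base ha => exact h₀ ha
  | step t ht _ hh ih => exact hJ t ⟨ht, ih⟩ ⟨_, hh, rfl⟩

lemma Trigger.IsOn.mono {T : Finset TGD} {I J : Instance} {t : Trigger} (h : t.IsOn T I)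
    (hIJ : I ⊆ J) : t.IsOn T J :=
  ⟨h.1, fun a ha => hIJ (h.2 a ha)⟩

lemma Trigger.finite_result (t : Trigger) : t.result.Finite := by
  refine (t.tgd.head.finite_toSet.image fun b => b.map t.subst).subset ?_
  rintro _ ⟨b, hb, rfl⟩
  exact ⟨b, hb, rfl⟩

lemma Database.finite_toInstance (D : Database) : (Database.toInstance D).Finite := by
  refine (D.finite_toSet.image fun b => b.map GTerm.const).subset ?_
  rintro _ ⟨b, hb, rfl⟩
  exact ⟨b, hb, rfl⟩

lemma ChaseStep.ssubset {T : Finset TGD} {I J : Instance} (h : ChaseStep T I J) : I ⊂ J := by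
  obtain ⟨t, ht, rfl⟩ := h
  refine ⟨Set.subset_union_left, fun hs => ht.2 ?_⟩
  exact Set.subset_union_right.trans hs

lemma ChaseStep.subset_chase {T : Finset TGD} {I J I₀ : Instance} (h : ChaseStep T I J)
    (hI : I ⊆ chase T I₀) : J ⊆ chase T I₀ := by
  obtain ⟨t, ht, rfl⟩ := h
  exact Set.union_subset hI (Trigger.result_subset_chase (ht.1.mono hI))

lemma ChaseStep.finite {T : Finset TGD} {I J : Instance} (h : ChaseStep T I J)
    (hI : I.Finite) : J.Finite := by
  obtain ⟨t, -, rfl⟩ := h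
  exact hI.union t.finite_result

/-! ### Results of valid derivations -/

lemma fin_prop_induction {T : Finset TGD} {n : ℕ} {I : Fin (n + 1) → Instance}
    (hstep : ∀ i : Fin n, ChaseStep T (I i.castSucc) (I i.succ)) {p : Instance → Prop}
    (h₀ : p (I 0)) (hp : ∀ J K, ChaseStep T J K → p J → p K) (i : Fin (n + 1)) : p (I i) := by
  induction i using Fin.induction with
  | zero => exact h₀
  | succ i ih => exact hp _ _ (hstep i) ih

/-- Chase steps never leave the least closed instance, and the result is itself closed: by the
stopping condition in the finite case, by fairness in the infinite one. -/
lemma result_of_isValid {D : Database} {T : Finset TGD} (hSL : IsSL T) {δ : ChaseSeq}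
    (hδ : δ.IsValid D T) : δ.result = chase T D.toInstance := by
  cases δ with
  | fin n I =>
    obtain ⟨⟨h0, hstep, hlast⟩, -⟩ := hδ
    refine Set.Subset.antisymm ?_ (chase_subset ?_ ?_)
    · exact fin_prop_induction hstep (p := fun J => J ⊆ chase T D.toInstance)
        (h0 ▸ subset_chase _ _) (fun _ _ h => h.subset_chase) _
    · exact fin_prop_induction hstep (p := fun J => D.toInstance ⊆ J)
        h0.ge (fun _ _ h hJ => hJ.trans h.ssubset.subset) _
    · intro t ht
      by_contra hs
      exact hlast ⟨t, ht, hs⟩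
  | inf I =>
    obtain ⟨⟨h0, hstep⟩, hfair⟩ := hδ
    have hmono : Monotone I := monotone_nat_of_le_succ fun i => (hstep i).ssubset.subset
    refine Set.Subset.antisymm (Set.iUnion_subset fun i => ?_) (chase_subset ?_ ?_)
    · induction i with
      | zero => exact h0 ▸ subset_chase _ _
      | succ i ih => exact (hstep i).subset_chase ih
    · exact h0 ▸ Set.subset_iUnion I 0
    · rintro t ⟨htT, htb⟩
      obtain ⟨b, hb, -⟩ := hSL _ htT
      -- The body is one atom, so a single stage of the derivation already contains it.
      obtain ⟨i, hi⟩ := Set.mem_iUnion.1 (htb b (by simp [hb]))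
      have hon : t.IsOn T (I i) := ⟨htT, fun a ha => by
        rw [hb, Finset.mem_singleton] at ha
        exact ha ▸ hi⟩
      by_cases hs : t.result ⊆ I i
      · exact hs.trans (Set.subset_iUnion I i)
      · obtain ⟨j, hj, hna⟩ := hfair i t ⟨hon, hs⟩
        have : t.result ⊆ I j := by
          by_contra hs'
          exact hna ⟨hon.mono (hmono hj.le), hs'⟩
        exact this.trans (Set.subset_iUnion I j)

lemma finite_result_of_isFinite {D : Database} {T : Finset TGD} {δ : ChaseSeq}
    (hδ : δ.IsDerivation D T) (hf : δ.IsFinite) : δ.result.Finite := by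
  cases δ with
  | fin n I =>
    exact fin_prop_induction hδ.2.1 (p := Set.Finite) (hδ.1 ▸ D.finite_toInstance)
      (fun _ _ h => h.finite) _
  | inf I => exact hf.elim

/-- A strictly increasing sequence of sets leaves every finite set behind. -/
lemma not_strictMono_of_finite {α : Type*} {S : Set α} (hS : S.Finite) (I : ℕ → Set α)
    (hI : ∀ i, I i ⊂ I (i + 1)) (hIS : ∀ i, I i ⊆ S) : False := by
  have : ∀ i, i ≤ (I i).ncard := by
    intro i
    induction i with
    | zero => exact Nat.zero_le _
    | succ i ih => exact ih.trans_lt (Set.ncard_lt_ncard (hI i) (hS.subset (hIS _)))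
  have h1 := this (S.ncard + 1)
  have h2 := Set.ncard_le_ncard (hIS (S.ncard + 1)) hS
  omega

lemma isFinite_of_finite_chase {D : Database} {T : Finset TGD}
    (hfin : (chase T D.toInstance).Finite) {δ : ChaseSeq} (hδ : δ.IsDerivation D T) :
    δ.IsFinite := by
  cases δ with
  | fin n I => trivial
  | inf I =>
    refine not_strictMono_of_finite hfin I (fun i => (hδ.2 i).ssubset) fun i => ?_
    induction i with
    | zero => exact hδ.1 ▸ subset_chase _ _
    | succ i ih => exact (hδ.2 i).subset_chase ih

/-! ### Finite over-approximations of the chase -/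

/-- `Trigger.subst` in terms of the restriction of the homomorphism to the frontier. -/
def homSubst (σ : TGD) (h : {y : Var // y ∈ σ.frontier} → GTerm) (x : Var) : GTerm :=
  if hx : x ∈ σ.frontier then h ⟨x, hx⟩ else GTerm.null σ x h

lemma Trigger.subst_eq (t : Trigger) : t.subst = homSubst t.tgd fun y => t.hom y.1 := by
  funext x
  unfold Trigger.subst homSubst
  split_ifs <;> rfl

open Classical in
/-- All atoms obtained from heads of `T` by mapping the frontier into the terms of an atom
of `G`. -/
noncomputable def expand (T : Finset TGD) (G : Finset (Atom GTerm)) : Finset (Atom GTerm) :=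
  G.biUnion fun g => T.biUnion fun σ => σ.head.biUnion fun b =>
    (Finset.univ : Finset ({y : Var // y ∈ σ.frontier} → Fin g.pred.arity)).image
      fun f => b.map (homSubst σ fun y => g.args (f y))

/-- The values on the frontier determine the whole result, null names included. So `g` need not be
the image of the body: it only has to carry those values. -/
lemma mem_expand {T : Finset TGD} {G : Finset (Atom GTerm)} {g : Atom GTerm} (hg : g ∈ G)
    {t : Trigger} (ht : t.tgd ∈ T) {b : Atom Var} (hb : b ∈ t.tgd.head)
    (h : ∀ y ∈ t.tgd.frontier, ∃ i, g.args i = t.hom y) : b.map t.subst ∈ expand T G := by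
  choose f hf using fun y : {y : Var // y ∈ t.tgd.frontier} => h y.1 y.2
  simp only [expand, Finset.mem_biUnion, Finset.mem_image, Finset.mem_univ, true_and]
  exact ⟨g, hg, t.tgd, ht, b, hb, f, by rw [t.subst_eq]; simp only [hf]⟩

/-- The iterates of `expand`. -/
noncomputable def levels (T : Finset TGD) (G : Finset (Atom GTerm)) : ℕ → Finset (Atom GTerm)
  | 0 => G
  | k + 1 => expand T (levels T G k)

lemma pred_mem_sch_of_head {T : Finset TGD} {σ : TGD} (hσ : σ ∈ T) {b : Atom Var}
    (hb : b ∈ σ.head) : b.pred ∈ sch T :=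
  Finset.mem_image_of_mem _ (Finset.mem_biUnion.2 ⟨σ, hσ, Finset.mem_union_right _ hb⟩)

lemma pred_mem_sch_of_body {T : Finset TGD} {σ : TGD} (hσ : σ ∈ T) {b : Atom Var}
    (hb : b ∈ σ.body) : b.pred ∈ sch T :=
  Finset.mem_image_of_mem _ (Finset.mem_biUnion.2 ⟨σ, hσ, Finset.mem_union_left _ hb⟩)

lemma arity_le_ar {T : Finset TGD} {P : Predicate} (hP : P ∈ sch T) : P.arity ≤ ar T :=
  Finset.le_sup (f := Predicate.arity) hP

lemma pred_mem_sch_of_mem_expand {T : Finset TGD} {G : Finset (Atom GTerm)} {a : Atom GTerm}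
    (ha : a ∈ expand T G) : a.pred ∈ sch T := by
  simp only [expand, Finset.mem_biUnion, Finset.mem_image] at ha
  obtain ⟨g, -, σ, hσ, b, hb, f, -, rfl⟩ := ha
  exact pred_mem_sch_of_head hσ hb

lemma TGD.IsSimpleLinear.exists_arg {σ : TGD} {a : Atom Var} (ha : σ.body = {a}) {y : Var}
    (hy : y ∈ σ.frontier) : ∃ i, a.args i = y := by
  have := (Finset.mem_inter.1 hy).1
  simpa [TGD.bodyVars, ha, Atom.vars] using this

lemma card_frontier_le {T : Finset TGD} (hSL : IsSL T) {σ : TGD} (hσ : σ ∈ T) :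
    σ.frontier.card ≤ ar T := by
  obtain ⟨a, ha, -⟩ := hSL σ hσ
  calc σ.frontier.card ≤ a.vars.card := Finset.card_le_card fun y hy => by
        obtain ⟨i, rfl⟩ := TGD.IsSimpleLinear.exists_arg ha hy
        exact Finset.mem_image_of_mem _ (Finset.mem_univ _)
    _ ≤ a.pred.arity := Finset.card_image_le.trans (by simp)
    _ ≤ ar T := arity_le_ar (pred_mem_sch_of_body hσ (by simp [ha]))

/-- Arities are positive, so each atom contains a variable, and TGDs without common variables have
disjoint heads. -/
lemma sum_card_head_le {T : Finset TGD} (hT : StandardizedApart T) :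
    ∑ σ ∈ T, σ.head.card ≤ (atoms T).card := by
  rw [← Finset.card_biUnion]
  · refine Finset.card_le_card fun b hb => ?_
    obtain ⟨σ, hσ, hb⟩ := Finset.mem_biUnion.1 hb
    exact Finset.mem_biUnion.2 ⟨σ, hσ, Finset.mem_union_right _ hb⟩
  · intro σ hσ τ hτ hne
    refine Finset.disjoint_left.2 fun b hb hb' => ?_
    have key : ∀ ρ : TGD, b ∈ ρ.head → b.args ⟨0, b.pred.arity_pos⟩ ∈ ρ.vars := fun ρ h =>
      Finset.mem_union_right _ (Finset.mem_biUnion.2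
        ⟨b, h, Finset.mem_image_of_mem _ (Finset.mem_univ _)⟩)
    exact Finset.disjoint_left.1 (hT σ hσ τ hτ hne) (key σ hb) (key τ hb')

lemma card_expand_le {T : Finset TGD} (hSL : IsSL T) (hT : StandardizedApart T)
    {G : Finset (Atom GTerm)} (hG : ∀ g ∈ G, g.pred.arity ≤ ar T) :
    (expand T G).card ≤ G.card * ((atoms T).card * ar T ^ ar T) := by
  classical
  refine Finset.card_biUnion_le_card_mul _ _ _ fun g hg => ?_
  refine Finset.card_biUnion_le.trans ?_
  refine le_trans ?_ (Nat.mul_le_mul_right _ (sum_card_head_le hT))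
  rw [Finset.sum_mul]
  refine Finset.sum_le_sum fun σ hσ => ?_
  refine Finset.card_biUnion_le_card_mul _ _ _ fun b _ => ?_
  refine Finset.card_image_le.trans ?_
  have hpos : 0 < ar T := g.pred.arity_pos.trans_le (hG g hg)
  simp only [Finset.card_univ, Fintype.card_fun, Fintype.card_fin, Fintype.card_coe]
  exact (Nat.pow_le_pow_left (hG g hg) _).trans
    (Nat.pow_le_pow_right hpos (card_frontier_le hSL hσ))

lemma arity_le_of_mem_levels {T : Finset TGD} {α : Atom GTerm} (hα : α.pred ∈ sch T) (k : ℕ) :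
    ∀ g ∈ levels T {α} k, g.pred.arity ≤ ar T := by
  intro g hg
  cases k with
  | zero => exact arity_le_ar (by rwa [Finset.mem_singleton.1 hg])
  | succ k => exact arity_le_ar (pred_mem_sch_of_mem_expand hg)

lemma card_levels_le {T : Finset TGD} (hSL : IsSL T) (hT : StandardizedApart T)
    {α : Atom GTerm} (hα : α.pred ∈ sch T) (k : ℕ) :
    (levels T {α} k).card ≤ ((atoms T).card * ar T ^ ar T) ^ k := by
  induction k with
  | zero => simp [levels]
  | succ k ih =>
    rw [pow_succ]
    exact (card_expand_le hSL hT (arity_le_of_mem_levels hα k)).trans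
      (Nat.mul_le_mul_right _ ih)

/-! ### Existence of valid derivations -/

/-- Each derivation step moves up one level because its body is one atom. This makes the infimum
defining `Trigger.rank` attained rather than the default 0. -/
lemma Trigger.exists_result_subset_levels {T : Finset TGD} (hSL : IsSL T) {D : Database}
    {G : Finset (Atom GTerm)} (hG : ∀ a ∈ D.toInstance, a ∈ G) {t : Trigger}
    (ht : t.IsOn T (chase T D.toInstance)) : ∃ n, t.result ⊆ levels T G n := by
  have hsucc : ∀ (t : Trigger) (n : ℕ), t.tgd ∈ T →
      (∀ a ∈ t.tgd.body, a.map t.hom ∈ levels T G n) → t.result ⊆ levels T G (n + 1) := by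
    rintro t n ht hn _ ⟨b, hb, rfl⟩
    obtain ⟨a, ha, -⟩ := hSL _ ht
    refine mem_expand (hn a (by simp [ha])) ht hb fun y hy => ?_
    obtain ⟨i, rfl⟩ := TGD.IsSimpleLinear.exists_arg ha hy
    exact ⟨i, rfl⟩
  have hmem : ∀ a, Derivable T D.toInstance a → ∃ n, a ∈ levels T G n := by
    intro a h
    induction h with
    | base h => exact ⟨0, hG _ h⟩
    | step t ht _ hh ih =>
      obtain ⟨a, ha, -⟩ := hSL _ ht
      obtain ⟨n, hn⟩ := ih a (by simp [ha])
      exact ⟨n + 1, hsucc t n ht (by simpa [ha] using hn) ⟨_, hh, rfl⟩⟩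
  obtain ⟨a, ha, -⟩ := hSL _ ht.1
  obtain ⟨n, hn⟩ := hmem _ (ht.2 a (by simp [ha]))
  exact ⟨n + 1, hsucc t n ht.1 (by simpa [ha] using hn)⟩

/-- The least level that contains the result of the trigger. -/
noncomputable def Trigger.rank (T : Finset TGD) (G : Finset (Atom GTerm)) (t : Trigger) : ℕ :=
  sInf {n | t.result ⊆ levels T G n}

open Classical in
/-- Apply an active trigger of least rank, if there is one. -/
noncomputable def fairStep (T : Finset TGD) (G : Finset (Atom GTerm)) (I : Instance) : Instance :=
  if h : ∃ t : Trigger, t.IsActive T I then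
    I ∪ (Function.argminOn (Trigger.rank T G) {t | t.IsActive T I} h).result
  else I

lemma fairStep_spec (T : Finset TGD) (G : Finset (Atom GTerm)) {I : Instance}
    (h : ∃ t : Trigger, t.IsActive T I) :
    ∃ t : Trigger, t.IsActive T I ∧ fairStep T G I = I ∪ t.result ∧
      ∀ u : Trigger, u.IsActive T I → t.rank T G ≤ u.rank T G :=
  ⟨_, Function.argminOn_mem (Trigger.rank T G) {t | t.IsActive T I} h, by
    rw [fairStep, dif_pos h], fun _ hu =>
      Function.argminOn_le (Trigger.rank T G) {t | t.IsActive T I} hu⟩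

lemma exists_isValid (D : Database) {T : Finset TGD} (hSL : IsSL T) :
    ∃ δ : ChaseSeq, δ.IsValid D T := by
  classical
  set G : Finset (Atom GTerm) := D.finite_toInstance.toFinset
  set I : ℕ → Instance := fun i => (fairStep T G)^[i] D.toInstance with hIdef
  have hI : ∀ i, I (i + 1) = fairStep T G (I i) := fun i =>
    Function.iterate_succ_apply' _ _ _
  have hstep : ∀ i, (∃ t : Trigger, t.IsActive T (I i)) → ChaseStep T (I i) (I (i + 1)) := by
    intro i h
    obtain ⟨t, ht, he, -⟩ := fairStep_spec T G h
    exact ⟨t, ht, (hI i).trans he⟩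
  -- If some stage has no active trigger, the sequence is cut at the first such stage.
  by_cases hex : ∃ n, ¬ ∃ t : Trigger, t.IsActive T (I n)
  · refine ⟨.fin (Nat.find hex) fun i => I i, ⟨rfl, fun i => ?_, ?_⟩, trivial⟩
    · exact hstep i (not_not.1 (Nat.find_min hex i.2))
    · exact Nat.find_spec hex
  · push Not at hex
    have hchain : ∀ i, ChaseStep T (I i) (I (i + 1)) := fun i => hstep i (hex i)
    have hsub : ∀ i, I i ⊆ chase T D.toInstance := by
      intro i
      induction i with
      | zero => exact subset_chase _ _
      | succ i ih => exact (hchain i).subset_chase ih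
    have hrank : ∀ i (t : Trigger), t.IsActive T (I i) →
        t.result ⊆ levels T G (t.rank T G) := fun i t ht =>
      Nat.sInf_mem (Trigger.exists_result_subset_levels hSL (fun a ha => by simpa [G] using ha)
        (ht.1.mono (hsub i)))
    refine ⟨.inf I, ⟨rfl, hchain⟩, fun i t ht => ?_⟩
    by_contra hact
    push Not at hact
    have hact' : ∀ j, t.IsActive T (I (i + j)) := fun j => by
      rcases Nat.eq_zero_or_pos j with rfl | hj
      · exact ht
      · exact hact _ (by omega)
    -- If `t` stayed active forever, every later step would apply a trigger of rank at most that of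
    -- `t`, hence add a new atom of the finite set `L`.
    set L : Set (Atom GTerm) :=
      ⋃ n ∈ Finset.range (t.rank T G + 1), (levels T G n : Set (Atom GTerm))
    have hL : L.Finite := Set.Finite.biUnion (Finset.finite_toSet _) fun n _ =>
      Finset.finite_toSet _
    refine not_strictMono_of_finite hL (fun j => I (i + j) ∩ L) (fun j => ?_)
      fun j => Set.inter_subset_right
    obtain ⟨u, hu, he, hmin⟩ := fairStep_spec T G ⟨t, hact' j⟩
    have he' : I (i + (j + 1)) = I (i + j) ∪ u.result := (hI (i + j)).trans he
    have huL : u.result ⊆ L := (hrank _ u hu).trans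
      (Set.subset_biUnion_of_mem (u := fun n => (levels T G n : Set (Atom GTerm)))
        (Finset.mem_coe.2 (Finset.mem_range.2 (Nat.lt_succ_of_le (hmin t (hact' j))))))
    simp only [he']
    refine ⟨Set.inter_subset_inter_left _ Set.subset_union_left, fun hs => hu.2 fun a ha => ?_⟩
    exact (hs ⟨Or.inr ha, huL ha⟩).1

/-! ### Depth of terms -/

/-- The nesting depth of a term. -/
def GTerm.depth : GTerm → ℕ
  | .const _ => 0
  | .null σ _ h => 1 + (Finset.univ : Finset {y : Var // y ∈ σ.frontier}).sup fun y => (h y).depth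

lemma Trigger.depth_subst_lt {t : Trigger} {x y : Var} (hx : x ∉ t.tgd.frontier)
    (hy : y ∈ t.tgd.frontier) : (t.hom y).depth < (t.subst x).depth := by
  have h := Finset.le_sup (f := fun y : {y : Var // y ∈ t.tgd.frontier} => (t.hom y.1).depth)
    (Finset.mem_univ ⟨y, hy⟩)
  simp only [Trigger.subst, if_neg hx, GTerm.depth]
  dsimp only at h
  omega

/-- The bound `1 ≤ m` covers an empty frontier, where the null has depth 1. -/
lemma Trigger.depth_subst_le {t : Trigger} {x : Var} (hx : x ∉ t.tgd.frontier) {m : ℕ}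
    (h1 : 1 ≤ m) (hm : ∀ y ∈ t.tgd.frontier, (t.hom y).depth < m) : (t.subst x).depth ≤ m := by
  have h : ((Finset.univ : Finset {y : Var // y ∈ t.tgd.frontier}).sup
      fun y => (t.hom y.1).depth) ≤ m - 1 :=
    Finset.sup_le fun y _ => Nat.le_sub_one_of_lt (hm y.1 y.2)
  simp only [Trigger.subst, if_neg hx, GTerm.depth]
  omega

/-- Any terms of depth at most `m` that occur together in an atom derivable from `α` occur
together in an atom of one of the first `m + 1` levels. -/
lemma exists_mem_levels {T : Finset TGD} (hSL : IsSL T) {α β : Atom GTerm}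
    (hβ : β ∈ chase T {α}) (X : Set GTerm) (hX : ∀ u ∈ X, ∃ i, β.args i = u) (m : ℕ)
    (hm : ∀ u ∈ X, u.depth ≤ m) :
    ∃ k ≤ m, ∃ g ∈ levels T {α} k, ∀ u ∈ X, ∃ i, g.args i = u := by
  induction hβ generalizing X m with
  | base ha =>
    obtain rfl := Set.mem_singleton_iff.1 ha
    exact ⟨0, Nat.zero_le _, _, Finset.mem_singleton_self _, hX⟩
  | @step t ht _ b hh ih =>
    obtain ⟨a, ha, -⟩ := hSL _ ht
    have hfr : ∀ y ∈ t.tgd.frontier, ∃ i, (a.map t.hom).args i = t.hom y := fun y hy => by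
      obtain ⟨i, rfl⟩ := TGD.IsSimpleLinear.exists_arg ha hy
      exact ⟨i, rfl⟩
    -- A null of `X` created here is deeper than all frontier terms, so recursing on these with `m -
    -- 1` pays for one more level. Without such a null, `X` lies in the body atom and no level is
    -- spent.
    by_cases hnew : ∃ u ∈ X, ∃ x, x ∉ t.tgd.frontier ∧ t.subst x = u
    · obtain ⟨_, huX, x, hx, rfl⟩ := hnew
      have hlt : ∀ y ∈ t.tgd.frontier, (t.hom y).depth < m := fun y hy =>
        (Trigger.depth_subst_lt hx hy).trans_le (hm _ huX)
      have hm1 : 1 ≤ m := le_trans (by simp [Trigger.subst, hx, GTerm.depth]) (hm _ huX)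
      obtain ⟨k, hk, g, hg, hgy⟩ := ih a (by simp [ha]) (t.hom '' {y | y ∈ t.tgd.frontier})
        (by rintro _ ⟨y, hy, rfl⟩; exact hfr y hy) (m - 1)
        (by rintro _ ⟨y, hy, rfl⟩; exact Nat.le_sub_one_of_lt (hlt y hy))
      exact ⟨k + 1, by omega, _, mem_expand hg ht hh fun y hy => hgy _ ⟨y, hy, rfl⟩, hX⟩
    · push Not at hnew
      refine ih a (by simp [ha]) X (fun u hu => ?_) m hm
      obtain ⟨i, hi⟩ := hX u hu
      by_cases hx : b.args i ∈ t.tgd.frontier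
      · obtain ⟨j, hj⟩ := hfr _ hx
        refine ⟨j, hj.trans (.trans ?_ hi)⟩
        exact (if_pos hx).symm
      · exact (hnew u hu _ hx hi).elim

lemma pred_mem_sch_of_mem_chase {T : Finset TGD} {α β : Atom GTerm} (hα : α.pred ∈ sch T)
    (hβ : β ∈ chase T {α}) : β.pred ∈ sch T := by
  cases hβ with
  | base ha => rwa [Set.mem_singleton_iff.1 ha]
  | step t ht _ hh => exact pred_mem_sch_of_head ht hh

lemma chase_singleton_of_pred_notMem {T : Finset TGD} (hSL : IsSL T) {α : Atom GTerm}
    (hα : α.pred ∉ sch T) : chase T {α} ⊆ {α} := by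
  refine chase_subset subset_rfl ?_
  rintro t ⟨ht, hb⟩
  obtain ⟨a, ha, -⟩ := hSL _ ht
  have h : a.map t.hom = α := hb a (by simp [ha])
  exact (hα (h ▸ pred_mem_sch_of_body ht (by simp [ha]))).elim

/-- With M = A·s·r, both A and s are at most M ≤ M^r, and r ≤ M; so each factor A·r^r or s·r^r is at
most M^(2r), and there are k + 1 of them. -/
lemma levels_bound_le {A s r d : ℕ} (hA : 0 < A) (hs : 0 < s) (hr : 0 < r) {k : ℕ} (hk : k ≤ d) :
    (A * r ^ r) ^ k * (s * r ^ r) ≤ (A * s * r) ^ (2 * r * (d + 1)) := by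
  have hM : 0 < A * s * r := by positivity
  have hrM : r ^ r ≤ (A * s * r) ^ r :=
    Nat.pow_le_pow_left (Nat.le_mul_of_pos_left _ (by positivity)) _
  have key : ∀ c, c ≤ A * s * r → c * r ^ r ≤ (A * s * r) ^ (2 * r) := by
    intro c hc
    calc c * r ^ r ≤ (A * s * r) ^ r * (A * s * r) ^ r :=
          Nat.mul_le_mul (hc.trans (Nat.le_self_pow hr.ne' _)) hrM
      _ = (A * s * r) ^ (2 * r) := by rw [← pow_add, two_mul]
  have hA' : A ≤ A * s * r := by
    rw [mul_assoc]; exact Nat.le_mul_of_pos_right _ (by positivity)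
  have hs' : s ≤ A * s * r := by
    rw [mul_comm A s, mul_assoc]; exact Nat.le_mul_of_pos_right _ (by positivity)
  calc (A * r ^ r) ^ k * (s * r ^ r)
      ≤ ((A * s * r) ^ (2 * r)) ^ k * (A * s * r) ^ (2 * r) :=
        Nat.mul_le_mul (Nat.pow_le_pow_left (key A hA') _) (key s hs')
    _ = (A * s * r) ^ (2 * r * (k + 1)) := by rw [← pow_succ, ← pow_mul]
    _ ≤ _ := Nat.pow_le_pow_right hM (Nat.mul_le_mul_left _ (by omega))

lemma fSL_pos (T : Finset TGD) : 0 < fSL T := by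
  refine Nat.mul_pos (Nat.succ_pos _) ?_
  rcases Nat.eq_zero_or_pos (ar T) with h | h
  · simp [h]
  · have hs : (sch T).Nonempty := by
      by_contra hs
      rw [Finset.not_nonempty_iff_eq_empty] at hs
      simp [ar, hs] at h
    have hA : (atoms T).Nonempty := Finset.image_nonempty.1 hs
    exact Nat.pow_pos (Nat.mul_pos (Nat.mul_pos hA.card_pos hs.card_pos) h)

/-- If the depth is bounded by `dSL T`, a single atom derives at most `fSL T` atoms. -/
lemma exists_finset_chase_singleton {T : Finset TGD} (hSL : IsSL T) (hT : StandardizedApart T)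
    {α : Atom GTerm} (hd : ∀ β ∈ chase T {α}, ∀ i, (β.args i).depth ≤ dSL T) :
    ∃ B : Finset (Atom GTerm), chase T {α} ⊆ B ∧ B.card ≤ fSL T := by
  classical
  by_cases hα : α.pred ∈ sch T
  swap
  · exact ⟨{α}, by simpa using chase_singleton_of_pred_notMem hSL hα, by
      simpa using Nat.succ_le_of_lt (fSL_pos T)⟩
  -- The candidates: any predicate of the schema, filled with terms of one atom `g` of a level up to
  -- `dSL T`.
  refine ⟨(Finset.range (dSL T + 1)).biUnion fun k => (levels T {α} k).biUnion fun g =>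
    (sch T).biUnion fun P => (Finset.univ : Finset (Fin P.arity → Fin g.pred.arity)).image
      fun f => ⟨P, fun i => g.args (f i)⟩, fun β hβ => ?_, ?_⟩
  · obtain ⟨k, hk, g, hg, hgX⟩ := exists_mem_levels hSL hβ (Set.range β.args)
      (fun _ h => h) (dSL T) (by rintro _ ⟨i, rfl⟩; exact hd β hβ i)
    choose f hf using fun i => hgX (β.args i) ⟨i, rfl⟩
    simp only [Finset.coe_biUnion, Set.mem_iUnion, Finset.mem_coe, Finset.mem_image,
      Finset.mem_univ, true_and, Finset.mem_range, exists_prop]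
    refine ⟨k, by omega, g, hg, β.pred, pred_mem_sch_of_mem_chase hα hβ, f, ?_⟩
    simp only [hf]
  · have hr : 0 < ar T := α.pred.arity_pos.trans_le (arity_le_ar hα)
    have hs : (sch T).Nonempty := ⟨_, hα⟩
    have hA : (atoms T).Nonempty := Finset.image_nonempty.1 hs
    refine (Finset.card_biUnion_le_card_mul _ _ (size T ^ (2 * ar T * (dSL T + 1))) ?_).trans
      (by rw [Finset.card_range, fSL])
    intro k hk
    refine le_trans ?_ (levels_bound_le hA.card_pos hs.card_pos hr
      (Nat.lt_succ_iff.1 (Finset.mem_range.1 hk)))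
    refine le_trans ?_ (Nat.mul_le_mul_right _ (card_levels_le hSL hT hα k))
    refine Finset.card_biUnion_le_card_mul _ _ _ fun g hg => ?_
    refine Finset.card_biUnion_le_card_mul _ _ _ fun P hP => ?_
    refine Finset.card_image_le.trans ?_
    simp only [Finset.card_univ, Fintype.card_fun, Fintype.card_fin]
    exact (Nat.pow_le_pow_left (arity_le_of_mem_levels hα k g hg) _).trans
      (Nat.pow_le_pow_right hr (arity_le_ar hP))

/-- With single-atom bodies a derivation is a path, which starts at one atom of `I₀`. -/
lemma exists_mem_chase_singleton {T : Finset TGD} (hSL : IsSL T) {I₀ : Instance}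
    {β : Atom GTerm} (hβ : β ∈ chase T I₀) : ∃ α ∈ I₀, β ∈ chase T {α} := by
  induction hβ with
  | base ha => exact ⟨_, ha, subset_chase _ _ rfl⟩
  | step t ht _ hh ih =>
    obtain ⟨a, ha, -⟩ := hSL _ ht
    obtain ⟨α, hα, h⟩ := ih a (by simp [ha])
    exact ⟨α, hα, Derivable.step t ht (fun c hc => by
      rw [ha, Finset.mem_singleton] at hc
      exact hc ▸ h) hh⟩

lemma chase_mono (T : Finset TGD) {I₀ I₁ : Instance} (h : I₀ ⊆ I₁) :
    chase T I₀ ⊆ chase T I₁ :=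
  chase_subset (h.trans (subset_chase _ _)) fun _ ht => Trigger.result_subset_chase ht

lemma encard_chase_le {D : Database} {T : Finset TGD} (hSL : IsSL T) (hT : StandardizedApart T)
    (hd : ∀ β ∈ chase T D.toInstance, ∀ i, (β.args i).depth ≤ dSL T) :
    (chase T D.toInstance).encard ≤ ((D.card * fSL T : ℕ) : ℕ∞) := by
  classical
  have hB : ∀ c : Atom Const, ∃ B : Finset (Atom GTerm), c ∈ D →
      chase T {c.map GTerm.const} ⊆ B ∧ B.card ≤ fSL T := by
    intro c
    by_cases hc : c ∈ D
    · obtain ⟨B, hB⟩ := exists_finset_chase_singleton hSL hT (α := c.map GTerm.const)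
        fun β hβ => hd β (chase_mono T
          (Set.singleton_subset_iff.2 (show c.map GTerm.const ∈ D.toInstance from ⟨c, hc, rfl⟩)) hβ)
      exact ⟨B, fun _ => hB⟩
    -- A default value, making `B` a total function.
    · exact ⟨∅, fun h => (hc h).elim⟩
  choose B hB using hB
  have hsub : chase T D.toInstance ⊆ (D.biUnion B : Finset (Atom GTerm)) := by
    intro β hβ
    obtain ⟨_, ⟨c, hc, rfl⟩, h⟩ := exists_mem_chase_singleton hSL hβ
    exact Finset.mem_coe.2 (Finset.mem_biUnion.2 ⟨c, hc, (hB c hc).1 h⟩)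
  refine (Set.encard_le_encard hsub).trans ?_
  rw [Set.encard_coe_eq_coe_finsetCard]
  exact_mod_cast Finset.card_biUnion_le_card_mul _ _ _ fun c hc => (hB c hc).2

/-! ### Weak-acyclicity bounds the depth -/

/-- There is an edge of some kind in the dependency graph. -/
def Edge (T : Finset TGD) (π π' : Position) : Prop := ∃ k, DepEdge T k π π'

lemma exists_walk {T : Finset TGD} {π π' : Position}
    (h : Relation.ReflTransGen (Edge T) π π') :
    ∃ (n : ℕ) (f : ℕ → Position) (k : ℕ → EdgeKind), f 0 = π ∧ f n = π' ∧
      ∀ i < n, DepEdge T (k i) (f i) (f (i + 1)) := by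
  induction h using Relation.ReflTransGen.head_induction_on with
  | refl => exact ⟨0, fun _ => π', fun _ => .normal, rfl, rfl, by simp⟩
  | @head a c hac _ ih =>
    obtain ⟨n, f, k, h0, hn, hi⟩ := ih
    obtain ⟨k₀, hk₀⟩ := hac
    refine ⟨n + 1, fun i => i.casesOn a f, fun i => i.casesOn k₀ k, rfl, hn, ?_⟩
    rintro (_ | i) h
    · change DepEdge T k₀ a (f 0)
      exact h0.symm ▸ hk₀
    · exact hi i (by omega)

/-- A walk back from `π'` to `π`, preceded by the special edge, would be a cycle supported at its
first node. -/
lemma not_reflTransGen_of_special {D : Database} {T : Finset TGD} (hW : WeaklyAcyclic D T)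
    {π π' : Position} (hs : ∃ a ∈ D, Reachable T a.pred π.pred)
    (hsp : DepEdge T .special π π') : ¬ Relation.ReflTransGen (Edge T) π' π := by
  intro h
  obtain ⟨n, f, k, h0, hn, hi⟩ := exists_walk h
  obtain ⟨a, ha, har⟩ := hs
  refine hW ⟨⟨n + 1, fun i => Nat.casesOn (motive := fun _ => Position) i.1 π f,
    fun i => Nat.casesOn (motive := fun _ => EdgeKind) i.1 .special k, ?_, hn.symm⟩,
    ⟨a, ha, 0, har⟩, ⟨0, rfl⟩⟩
  rintro ⟨_ | i, h⟩
  · change DepEdge T .special π (f 0)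
    exact h0.symm ▸ hsp
  · exact hi i (by omega)

lemma reachable_of_mem_chase {D : Database} {T : Finset TGD} (hSL : IsSL T) {β : Atom GTerm}
    (hβ : β ∈ chase T D.toInstance) (hp : β.pred ∈ sch T) :
    ∃ a ∈ D, Reachable T a.pred β.pred := by
  induction hβ with
  | base ha =>
    obtain ⟨a, ha, rfl⟩ := ha
    exact ⟨a, ha, .single ⟨hp, hp, Or.inl rfl⟩⟩
  | @step t ht _ b hh ih =>
    obtain ⟨c, hc, -⟩ := hSL _ ht
    have hcb : c ∈ t.tgd.body := by simp [hc]
    have hcs := pred_mem_sch_of_body ht hcb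
    obtain ⟨a, ha, h⟩ := ih c hcb hcs
    exact ⟨a, ha, h.tail ⟨hcs, pred_mem_sch_of_head ht hh,
      Or.inr ⟨t.tgd, ht, ⟨c, hcb, rfl⟩, b, hh, rfl⟩⟩⟩

open Classical in
/-- The positions over the schema of `T`. -/
noncomputable def positions (T : Finset TGD) : Finset Position :=
  (sch T).biUnion fun P => (Finset.univ : Finset (Fin P.arity)).image fun i => ⟨P, i⟩

lemma mem_positions {T : Finset TGD} {π : Position} (h : π.pred ∈ sch T) : π ∈ positions T := by
  classical
  exact Finset.mem_biUnion.2 ⟨π.pred, h, Finset.mem_image_of_mem _ (Finset.mem_univ π.idx)⟩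

lemma card_positions_le (T : Finset TGD) : (positions T).card ≤ dSL T := by
  classical
  exact Finset.card_biUnion_le_card_mul _ _ _ fun P hP =>
    Finset.card_image_le.trans (by simpa using arity_le_ar hP)

open Classical in
/-- The positions from which `π` can be reached in the dependency graph. -/
noncomputable def ancestors (T : Finset TGD) (π : Position) : Finset Position :=
  (positions T).filter fun ρ => Relation.ReflTransGen (Edge T) ρ π

lemma mem_ancestors {T : Finset TGD} {ρ π : Position} :
    ρ ∈ ancestors T π ↔ ρ ∈ positions T ∧ Relation.ReflTransGen (Edge T) ρ π := by
  classical
  exact Finset.mem_filter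

lemma ancestors_subset_positions (T : Finset TGD) (π : Position) :
    ancestors T π ⊆ positions T := fun _ hρ => (mem_ancestors.1 hρ).1

lemma ancestors_mono {T : Finset TGD} {π π' : Position} (h : Edge T π π') :
    ancestors T π ⊆ ancestors T π' := fun _ hρ =>
  mem_ancestors.2 ⟨(mem_ancestors.1 hρ).1, (mem_ancestors.1 hρ).2.tail h⟩

lemma self_mem_ancestors {T : Finset TGD} {π : Position} (h : π.pred ∈ sch T) :
    π ∈ ancestors T π :=
  mem_ancestors.2 ⟨mem_positions h, .refl⟩

lemma mem_exVars {σ : TGD} {b : Atom Var} (hb : b ∈ σ.head) {i : Fin b.pred.arity}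
    (hx : b.args i ∉ σ.frontier) : b.args i ∈ σ.exVars := by
  have hh : b.args i ∈ σ.headVars :=
    Finset.mem_biUnion.2 ⟨b, hb, Finset.mem_image_of_mem _ (Finset.mem_univ i)⟩
  exact Finset.mem_sdiff.2 ⟨hh, fun h => hx (Finset.mem_inter.2 ⟨h, hh⟩)⟩

lemma depth_le_card_ancestors {D : Database} {T : Finset TGD} (hSL : IsSL T)
    (hW : WeaklyAcyclic D T) {β : Atom GTerm} (hβ : β ∈ chase T D.toInstance)
    (i : Fin β.pred.arity) : (β.args i).depth ≤ (ancestors T ⟨β.pred, i⟩).card := by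
  induction hβ with
  | base ha =>
    obtain ⟨a, -, rfl⟩ := ha
    exact Nat.zero_le _
  | @step t ht hb b hh ih =>
    obtain ⟨a, ha, -⟩ := hSL _ ht
    have hab : a ∈ t.tgd.body := by simp [ha]
    have hbs := pred_mem_sch_of_head ht hh
    change Fin b.pred.arity at i
    change (t.subst (b.args i)).depth ≤ (ancestors T ⟨b.pred, i⟩).card
    by_cases hx : b.args i ∈ t.tgd.frontier
    · obtain ⟨j, hj⟩ := TGD.IsSimpleLinear.exists_arg ha hx
      have hE : Edge T ⟨a.pred, j⟩ ⟨b.pred, i⟩ :=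
        ⟨.normal, t.tgd, ht, _, hx, ⟨a, hab, j, hj, rfl⟩, b, hh, i, rfl, rfl⟩
      rw [Trigger.subst, if_pos hx, ← hj]
      exact (ih a hab j).trans (Finset.card_le_card (ancestors_mono hE))
    · have hself := self_mem_ancestors (T := T) (π := ⟨b.pred, i⟩) hbs
      refine Trigger.depth_subst_le hx (Finset.card_pos.2 ⟨_, hself⟩) fun y hy => ?_
      obtain ⟨j, rfl⟩ := TGD.IsSimpleLinear.exists_arg ha hy
      have hE : DepEdge T .special ⟨a.pred, j⟩ ⟨b.pred, i⟩ :=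
        ⟨t.tgd, ht, _, hy, ⟨a, hab, j, rfl, rfl⟩, _, mem_exVars hh hx, b, hh, i, rfl, rfl⟩
      refine (ih a hab j).trans_lt (Finset.card_lt_card
        -- The inclusion is strict: the head position is its own ancestor, but not one of the body
        -- position.
        ⟨ancestors_mono ⟨_, hE⟩, fun hs => ?_⟩)
      exact not_reflTransGen_of_special hW
        (reachable_of_mem_chase hSL (hb a hab) (pred_mem_sch_of_body ht hab)) hE
        (mem_ancestors.1 (hs hself)).2

/-! ### Supported special cycles make the chase infinite -/

/-- Every atom over the body predicate of a simple linear TGD is the image of its body. -/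
lemma exists_trigger {T : Finset TGD} {σ : TGD} (hσ : σ ∈ T) {a : Atom Var}
    (ha : σ.body = {a}) (hinj : Function.Injective a.args) {I : Instance} {β : Atom GTerm}
    (hβ : β ∈ I) (hp : β.pred = a.pred) :
    ∃ h : Var → GTerm, Trigger.IsOn ⟨σ, h⟩ T I ∧ a.map h = β := by
  obtain ⟨P, args⟩ := β
  obtain rfl : P = a.pred := hp
  -- No variable repeats in `a`, so any argument tuple defines a homomorphism; its value off the
  -- body is irrelevant.
  have he : a.map (Function.extend a.args args fun _ => .const 0) = ⟨a.pred, args⟩ := by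
    simp only [Atom.map, hinj.extend_apply]
  refine ⟨_, ⟨hσ, fun c hc => ?_⟩, he⟩
  obtain rfl : c = a := by simpa [ha] using hc
  exact he.symm ▸ hβ

lemma exists_mem_chase_of_reachable {T : Finset TGD} (hSL : IsSL T) {I₀ : Instance}
    {R P : Predicate} (h : Reachable T R P) (hR : ∃ β ∈ chase T I₀, β.pred = R) :
    ∃ β ∈ chase T I₀, β.pred = P := by
  have hstep : ∀ {R P}, PredStep T R P → (∃ β ∈ chase T I₀, β.pred = R) →
      ∃ β ∈ chase T I₀, β.pred = P := by
    rintro R P ⟨-, -, rfl | ⟨σ, hσ, ⟨b, hb, rfl⟩, c, hc, rfl⟩⟩ hR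
    · exact hR
    · obtain ⟨β, hβ, hp⟩ := hR
      obtain ⟨a, ha, hinj⟩ := hSL σ hσ
      obtain rfl : b = a := by simpa [ha] using hb
      obtain ⟨h, hon, -⟩ := exists_trigger hσ ha hinj hβ hp
      exact ⟨_, Trigger.result_subset_chase hon ⟨c, hc, rfl⟩, rfl⟩
  induction h with
  | single h => exact hstep h hR
  | tail _ h ih => exact hstep h ih

/-- The increase in depth along an edge. -/
def EdgeKind.weight : EdgeKind → ℕ
  | .normal => 0
  | .special => 1

/-- Some atom of `I` has a term of depth at least `m` at position `π`. -/
def HasDepthAt (I : Instance) (π : Position) (m : ℕ) : Prop :=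
  ∃ args : Fin π.pred.arity → GTerm, (⟨π.pred, args⟩ : Atom GTerm) ∈ I ∧ m ≤ (args π.idx).depth

/-- The rule behind the edge fires on the given atom: its head repeats the deep term along a normal
edge, and nests it inside a new null along a special one. -/
lemma HasDepthAt.edge {T : Finset TGD} (hSL : IsSL T) {I₀ : Instance} {π π' : Position} {m : ℕ}
    {k : EdgeKind} (h : HasDepthAt (chase T I₀) π m) (hE : DepEdge T k π π') :
    HasDepthAt (chase T I₀) π' (m + k.weight) := by
  obtain ⟨args, hmem, hm⟩ := h
  obtain ⟨σ, hσ, x, hx, ⟨b, hb, i, hi, rfl⟩, hk⟩ := hE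
  obtain ⟨a, ha, hinj⟩ := hSL σ hσ
  obtain rfl : b = a := by simpa [ha] using hb
  obtain ⟨h, hon, he⟩ := exists_trigger hσ ha hinj hmem rfl
  have hargs : args = fun j => h (b.args j) := by
    have := (Atom.mk.injEq _ _ _ _).mp he
    exact (eq_of_heq this.2).symm
  have hmx : m ≤ (h x).depth := by
    rw [hargs] at hm
    exact hi ▸ hm
  cases k with
  | normal =>
    obtain ⟨c, hc, j, hj, rfl⟩ := hk
    refine ⟨_, Trigger.result_subset_chase hon ⟨c, hc, rfl⟩, ?_⟩
    dsimp only
    rw [hj, Trigger.subst, if_pos hx]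
    exact hmx
  | special =>
    obtain ⟨z, hz, c, hc, j, hj, rfl⟩ := hk
    refine ⟨_, Trigger.result_subset_chase hon ⟨c, hc, rfl⟩, ?_⟩
    dsimp only
    rw [hj]
    have hzf : z ∉ σ.frontier := fun hzf =>
      (Finset.mem_sdiff.1 hz).2 (Finset.mem_inter.1 hzf).1
    exact Nat.succ_le_of_lt (hmx.trans_lt (Trigger.depth_subst_lt (t := ⟨σ, h⟩) hzf hx))

lemma HasDepthAt.anti {I : Instance} {π : Position} {m n : ℕ} (h : HasDepthAt I π n)
    (hmn : m ≤ n) : HasDepthAt I π m :=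
  let ⟨args, ha, hn⟩ := h
  ⟨args, ha, hmn.trans hn⟩

lemma HasDepthAt.edge_le {T : Finset TGD} (hSL : IsSL T) {I₀ : Instance} {π π' : Position}
    {m : ℕ} {k : EdgeKind} (h : HasDepthAt (chase T I₀) π m) (hE : DepEdge T k π π') :
    HasDepthAt (chase T I₀) π' m :=
  (h.edge hSL hE).anti (Nat.le_add_right _ _)

lemma HasDepthAt.along {T : Finset TGD} (hSL : IsSL T) {I₀ : Instance} (C : DepCycle T) {m : ℕ}
    {i j : Fin (C.len + 1)} (hij : i ≤ j) (h : HasDepthAt (chase T I₀) (C.node i) m) :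
    HasDepthAt (chase T I₀) (C.node j) m := by
  induction j using Fin.induction with
  | zero => rwa [Fin.le_zero_iff.1 hij] at h
  | succ j ih =>
    rcases hij.eq_or_lt with rfl | hlt
    · exact h
    · exact (ih (Fin.le_castSucc_iff.2 hlt)).edge_le hSL (C.isEdge j)

lemma weaklyAcyclic_of_finite {D : Database} {T : Finset TGD} (hSL : IsSL T)
    (hfin : (chase T D.toInstance).Finite) : WeaklyAcyclic D T := by
  rintro ⟨C, ⟨a, ha, i, hi⟩, s, hs⟩
  have hzero : HasDepthAt (chase T D.toInstance) (C.node 0) 0 := by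
    obtain ⟨⟨P, args⟩, hβ, rfl⟩ := exists_mem_chase_of_reachable hSL hi
      ⟨_, subset_chase T _ (show a.map GTerm.const ∈ D.toInstance from ⟨a, ha, rfl⟩), rfl⟩
    have h : HasDepthAt (chase T D.toInstance) (C.node i) 0 := ⟨args, hβ, Nat.zero_le _⟩
    exact C.closed ▸ h.along hSL C (Fin.le_last i)
  have hall : ∀ m, HasDepthAt (chase T D.toInstance) (C.node 0) m := by
    intro m
    induction m with
    | zero => exact hzero
    | succ m ih =>
      -- One lap: from the start to the special edge, across it with a gain of one, then to the end,
      -- which is the start again.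
      have h1 := (ih.along hSL C (Fin.zero_le s.castSucc)).edge hSL (C.isEdge s)
      rw [hs] at h1
      exact C.closed ▸ h1.along hSL C (Fin.le_last _)
  obtain ⟨N, hN⟩ := (hfin.image fun β =>
    Finset.univ.sup fun i => (β.args i).depth).bddAbove
  obtain ⟨args, hmem, hle⟩ := hall (N + 1)
  have h1 := hN ⟨_, hmem, rfl⟩
  have h2 := Finset.le_sup (f := fun i => (args i).depth) (Finset.mem_univ (C.node 0).idx)
  dsimp only at h1 h2
  omega

end SOChase

open SOChase
theorem mainTheorem3 (D : Database) (T : Finset TGD)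
    (hSL : IsSL T) (hT : StandardizedApart T) :
    (∃! I : Instance, IsChaseResult D T I) ∧
    ∀ I : Instance, IsChaseResult D T I →
      List.TFAE [
        CTAll D T,
        CTEx D T,
        I.Finite,
        I.encard ≤ ((D.card * fSL T : ℕ) : ℕ∞),
        WeaklyAcyclic D T] := by
  obtain ⟨δ, hδ⟩ := exists_isValid D hSL
  have hres : ∀ I : Instance, IsChaseResult D T I → I = chase T D.toInstance := by
    rintro _ ⟨δ', hδ', rfl⟩
    exact result_of_isValid hSL hδ'
  refine ⟨⟨_, ⟨δ, hδ, rfl⟩, fun J hJ => (hres J hJ).trans (result_of_isValid hSL hδ).symm⟩,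
    fun I hI => ?_⟩
  obtain rfl := hres I hI
  tfae_have 1 → 2 := fun h => ⟨δ, hδ, h δ hδ⟩
  tfae_have 2 → 3 := by
    rintro ⟨δ', hδ', hf⟩
    exact result_of_isValid hSL hδ' ▸ finite_result_of_isFinite hδ'.1 hf
  tfae_have 3 → 1 := fun h δ' hδ' => isFinite_of_finite_chase h hδ'.1
  tfae_have 3 → 5 := weaklyAcyclic_of_finite hSL
  tfae_have 5 → 4 := fun h => encard_chase_le hSL hT fun β hβ i =>
    (depth_le_card_ancestors hSL h hβ i).trans
      ((Finset.card_le_card (ancestors_subset_positions T _)).trans (card_positions_le T))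
  tfae_have 4 → 3 := fun h =>
    Set.finite_of_encard_le_coe h
  tfae_finish
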